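/- Let $H$ and $K$ be $n\times n$ complex Hermitian matrices and $s\le t$ real numbers such that $e^{s}e^{H}\preceq_{ols}e^{K}\preceq_{ols}e^{t}e^{H}$, where for positive matrices $A\preceq_{ols}B$ (the Olson order) means that $A^{r}\le B^{r}$ in the Loewner order for every real $r\ge 1$. Let $\alpha\in[0,1]$. For positive definite $A,B$ let $A\sharp_\alpha B=A^{1/2}\big(A^{-1/2}BA^{-1/2}\big)^{\alpha}A^{1/2}$ be the weighted geometric mean, write $\sharp=\sharp_{1/2}$, and let $S(x)=\dfrac{(x-1)\,x^{1/(x-1)}}{e\log x}$ for $x>0$, $x\ne 1$, and $S(1)=1$, be the Specht ratio. Let $\|\cdot\|_u$ be any unitarily invariant norm on the $n\times n$ complex matrices, i.e. a norm with $\|UAV\|_u=\|A\|_u$ for all $A$ and all unitary $U,V$. Then for all $p>0$, $$\big\|e^{(1-\alpha)H+\alpha K}\big\|_u\le\big(\max\{S(e^{sp}),S(e^{tp})\}\big)^{1/p}\,\big\|\big(e^{pH}\sharp_\alpha e^{pK}\big)^{1/p}\big\|_u,$$ and the right-hand side converges to the left-hand side as $p\downarrow 0$. In particular, $$\big\|e^{H+K}\big\|_u\le\max\{S(e^{2s}),S(e^{2t})\}\,\big\|e^{2H}\sharp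 e^{2K}\big\|_u.$$ -/

import Mathlib

open scoped MatrixOrder Topology

/-- The Specht ratio `S(t) = (t - 1) t^{1/(t-1)} / (e log t)` for `t ≠ 1`, and `S(1) = 1`
(a function of positive reals `t`). -/
noncomputable def spechtRatio (t : ℝ) : ℝ :=
  if t = 1 then 1
  else (t - 1) * t ^ (1 / (t - 1)) / (Real.exp 1 * Real.log t)

/-- The Kubo-Ando weighted geometric mean
`A ♯_α B = A^{1/2} (A^{-1/2} B A^{-1/2})^α A^{1/2}` of positive definite matrices.
Real powers of matrices are those of the continuous functional calculus. -/
noncomputable def geomMean {n : Type*} [Fintype n] [DecidableEq n]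
    (α : ℝ) (A B : Matrix n n ℂ) : Matrix n n ℂ :=
  A ^ (1 / 2 : ℝ) * (A ^ (-(1 / 2) : ℝ) * B * A ^ (-(1 / 2) : ℝ)) ^ α * A ^ (1 / 2 : ℝ)

/-- The Olson (spectral) order on positive matrices: `A^r ≤ B^r` in the Loewner order
for every real `r ≥ 1`. -/
def OlsonLE {n : Type*} [Fintype n] [DecidableEq n] (A B : Matrix n n ℂ) : Prop :=
  ∀ r : ℝ, 1 ≤ r → A ^ r ≤ B ^ r

/-- `N` is a unitarily invariant norm on the complex vector space of square matrices. -/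
structure IsUnitarilyInvariantNorm {n : Type*} [Fintype n] [DecidableEq n]
    (N : Matrix n n ℂ → ℝ) : Prop where
  add_le : ∀ A B : Matrix n n ℂ, N (A + B) ≤ N A + N B
  smul_eq : ∀ (c : ℂ) (A : Matrix n n ℂ), N (c • A) = ‖c‖ * N A
  eq_zero_of_eq_zero : ∀ A : Matrix n n ℂ, N A = 0 → A = 0
  unitary_mul_mul : ∀ U ∈ Matrix.unitaryGroup n ℂ, ∀ V ∈ Matrix.unitaryGroup n ℂ,
    ∀ A : Matrix n n ℂ, N (U * A * V) = N A

/-! Everything happens at the level of logarithms. With `A = exp (pH)` and `B = exp (pK)`, the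
hypotheses give `e^{sp} A ≤ B ≤ e^{tp} A`. A reverse weighted AM-GM inequality then bounds `(1-α)A +
αB` by `M` times the geometric mean `G`, where `M` is the maximum of the two Specht ratios
(`weighted_geomMean_bounds`). Since the logarithm is operator concave and operator monotone,
dividing by `p` gives `(1-α)H + αK ≤ log (M^{1/p}) + (1/p) log G` (`logGeomMean_bounds`). Weyl's
principle turns this Loewner inequality into an inequality of ordered eigenvalues, hence of norms of
exponentials (`exp_le_exp`).

For the limit, `(1/p) log G` is also bounded above, via AM-GM and `log x ≤ x - 1`, by a weighted
mean of difference quotients of `exp`. Because `log S(e^y) = O(y²)`, `M^{1/p}` tends to 1, and both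
bounds tend to `(1-α)H + αK`. -/

/-! ### Scalar inequalities for the Specht ratio. -/

section Scalar

/-- Dividing by `(x-1)/log x > 0` reduces the claim to `v ≤ e^{v-1}` at `v = log x/(x-1) + α log x`.
-/
theorem add_mul_le_spechtRatio_mul_rpow (α : ℝ) {x : ℝ} (hx : 0 < x) :
    (1 - α) + α * x ≤ spechtRatio x * x ^ α := by
  unfold spechtRatio
  split_ifs with h1
  · simp [h1]
  have hx1 : x - 1 ≠ 0 := sub_ne_zero.2 h1
  have hL : Real.log x ≠ 0 := Real.log_ne_zero_of_pos_of_ne_one hx h1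
  have hc : 0 < (x - 1) / Real.log x := by
    rcases lt_or_gt_of_ne h1 with h | h
    · exact div_pos_of_neg_of_neg (by linarith) (Real.log_neg hx h)
    · exact div_pos (by linarith) (Real.log_pos h)
  have hu : (1 - α) + α * x =
      (x - 1) / Real.log x * (Real.log x / (x - 1) + α * Real.log x) := by
    field_simp
    ring
  have hS : (x - 1) * x ^ (1 / (x - 1)) / (Real.exp 1 * Real.log x) * x ^ α =
      (x - 1) / Real.log x * Real.exp (Real.log x / (x - 1) + α * Real.log x - 1) := by
    rw [Real.exp_sub, Real.exp_add, Real.rpow_def_of_pos hx, Real.rpow_def_of_pos hx,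
      mul_one_div, mul_comm α]
    field_simp
  rw [hu, hS]
  refine mul_le_mul_of_nonneg_left ?_ hc.le
  have := Real.add_one_le_exp (Real.log x / (x - 1) + α * Real.log x - 1)
  linarith

theorem one_le_spechtRatio {x : ℝ} (hx : 0 < x) : 1 ≤ spechtRatio x := by
  simpa using add_mul_le_spechtRatio_mul_rpow 0 hx

/-- After division by `x^α`, the left side is convex in `log x`, so its maximum over `[s, t]` is at
an endpoint. -/
theorem add_mul_le_max_spechtRatio_mul_rpow {α s t x : ℝ} (h0 : 0 ≤ α) (h1 : α ≤ 1)
    (hs : Real.exp s ≤ x) (ht : x ≤ Real.exp t) :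
    (1 - α) + α * x ≤
      max (spechtRatio (Real.exp s)) (spechtRatio (Real.exp t)) * x ^ α := by
  have hx : 0 < x := (Real.exp_pos s).trans_le hs
  have hconv : ConvexOn ℝ Set.univ
      (fun y : ℝ => (1 - α) * Real.exp (-α * y) + α * Real.exp ((1 - α) * y)) := by
    have key : ∀ c : ℝ, ConvexOn ℝ Set.univ (fun y : ℝ => Real.exp (c * y)) := fun c =>
      convexOn_exp.comp_linearMap (LinearMap.mul ℝ ℝ c)
    exact ((key (-α)).smul (sub_nonneg.2 h1)).add ((key (1 - α)).smul h0)
  have hg : ∀ y : ℝ, (1 - α) * Real.exp (-α * y) + α * Real.exp ((1 - α) * y) =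
      ((1 - α) + α * Real.exp y) * (Real.exp y ^ α)⁻¹ := by
    intro y
    rw [← Real.exp_mul, ← Real.exp_neg, add_mul, mul_assoc, ← Real.exp_add]
    ring_nf
  have hb : ∀ y : ℝ, (1 - α) * Real.exp (-α * y) + α * Real.exp ((1 - α) * y) ≤
      spechtRatio (Real.exp y) := by
    intro y
    rw [hg, ← div_eq_mul_inv, div_le_iff₀ (by positivity)]
    exact add_mul_le_spechtRatio_mul_rpow α (Real.exp_pos y)
  have hmax := hconv.le_max_of_mem_Icc (Set.mem_univ s) (Set.mem_univ t) (z := Real.log x)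
    ⟨(Real.le_log_iff_exp_le hx).2 hs, (Real.log_le_iff_le_exp hx).2 ht⟩
  have hfin := hmax.trans (max_le_max (hb s) (hb t))
  rwa [hg, Real.exp_log hx, ← div_eq_mul_inv, div_le_iff₀ (by positivity)] at hfin

/-- The bound is quadratic in `y`, so it survives the power `1/p` as `p ↓ 0`. It follows from
`S(e^y) = c e^{1/c-1}` and `c ≤ e^{c-1}`, with `c = (e^y-1)/y` within `|y|` of 1. -/
theorem spechtRatio_exp_le {y : ℝ} (hy : |y| ≤ 1 / 2) :
    spechtRatio (Real.exp y) ≤ Real.exp (2 * y ^ 2) := by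
  rcases eq_or_ne y 0 with rfl | hy0
  · simp [spechtRatio]
  have hne : Real.exp y ≠ 1 := by simpa using hy0
  set c := (Real.exp y - 1) / y with hc
  have hcy : |c - 1| ≤ |y| := by
    have h := Real.abs_exp_sub_one_sub_id_le (x := y) (by linarith)
    have hpos : 0 < |y| := abs_pos.2 hy0
    have : c - 1 = (Real.exp y - 1 - y) / y := by rw [hc]; field_simp
    rw [this, abs_div, div_le_iff₀ hpos, ← sq, sq_abs]
    exact h
  have hc2 : 1 / 2 ≤ c := by linarith [(abs_le.1 (hcy.trans hy)).1]
  have hcpos : 0 < c := by linarith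
  have hS : spechtRatio (Real.exp y) = c * Real.exp (1 / c - 1) := by
    have hx1 : Real.exp y - 1 ≠ 0 := sub_ne_zero.2 hne
    rw [spechtRatio, if_neg hne, Real.log_exp, ← Real.exp_mul, Real.exp_sub, hc, one_div_div,
      mul_one_div]
    field_simp
  have hc1 : c ≤ Real.exp (c - 1) := by linarith [Real.add_one_le_exp (c - 1)]
  calc spechtRatio (Real.exp y) ≤ Real.exp (c - 1) * Real.exp (1 / c - 1) := by
        rw [hS]; gcongr
    _ = Real.exp ((c - 1) ^ 2 / c) := by
        rw [← Real.exp_add]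
        congr 1
        field_simp
        ring
    _ ≤ Real.exp (2 * y ^ 2) := by
        have h2 : (c - 1) ^ 2 ≤ y ^ 2 := sq_le_sq.2 hcy
        rw [Real.exp_le_exp, div_le_iff₀ hcpos]
        nlinarith [sq_nonneg y]

theorem tendsto_max_spechtRatio_rpow (s t : ℝ) :
    Filter.Tendsto (fun p : ℝ =>
      (max (spechtRatio (Real.exp (s * p))) (spechtRatio (Real.exp (t * p)))) ^ (1 / p))
      (𝓝[>] 0) (𝓝 1) := by
  set m := max |s| |t| with hm
  have hub : Filter.Tendsto (fun p : ℝ => Real.exp (2 * m ^ 2 * p)) (𝓝[>] 0) (𝓝 1) := by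
    have : Continuous (fun p : ℝ => Real.exp (2 * m ^ 2 * p)) := by fun_prop
    simpa using (this.tendsto 0).mono_left nhdsWithin_le_nhds
  have hsmall : ∀ᶠ p : ℝ in 𝓝[>] 0, m * p ≤ 1 / 2 := by
    have : Continuous (fun p : ℝ => m * p) := by fun_prop
    have h := (this.tendsto 0).mono_left (nhdsWithin_le_nhds (s := Set.Ioi 0))
    rw [mul_zero] at h
    exact h.eventually_le_const (by norm_num)
  refine tendsto_of_tendsto_of_tendsto_of_le_of_le' tendsto_const_nhds hub ?_ ?_
  · filter_upwards [self_mem_nhdsWithin] with p hp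
    exact Real.one_le_rpow (le_max_of_le_left (one_le_spechtRatio (Real.exp_pos _)))
      (one_div_nonneg.2 (le_of_lt hp))
  · filter_upwards [self_mem_nhdsWithin, hsmall] with p hp hps
    have hp : 0 < p := hp
    have key : ∀ r : ℝ, |r| ≤ m → spechtRatio (Real.exp (r * p)) ≤ Real.exp (2 * (m * p) ^ 2) := by
      intro r hr
      have h1 : |r * p| ≤ m * p := by
        rw [abs_mul, abs_of_pos hp]
        gcongr
      refine (spechtRatio_exp_le (h1.trans hps)).trans ?_
      rw [Real.exp_le_exp, ← sq_abs (r * p)]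
      gcongr
    calc _ ≤ (Real.exp (2 * (m * p) ^ 2)) ^ (1 / p) := by
          refine Real.rpow_le_rpow ?_ (max_le (key s (le_max_left _ _)) (key t (le_max_right _ _)))
            (by positivity)
          exact zero_le_one.trans (le_max_of_le_left (one_le_spechtRatio (Real.exp_pos _)))
      _ = Real.exp (2 * m ^ 2 * p) := by
          rw [← Real.exp_mul]
          congr 1
          field_simp

end Scalar

/-! ### Weyl monotonicity of eigenvalues. -/

section Weyl

open Matrix

variable {n : Type*} [Fintype n] [DecidableEq n]

theorem Matrix.IsHermitian.star_dotProduct_mulVec_eq_sum {X : Matrix n n ℂ} (hX : X.IsHermitian)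
    (w : n → ℂ) :
    star w ⬝ᵥ (X *ᵥ w) = ((∑ j, hX.eigenvalues j *
      ‖((star (hX.eigenvectorUnitary : Matrix n n ℂ)) *ᵥ w) j‖ ^ 2 : ℝ) : ℂ) := by
  have h : X = (hX.eigenvectorUnitary : Matrix n n ℂ) *
      diagonal (RCLike.ofReal ∘ hX.eigenvalues) * star (hX.eigenvectorUnitary : Matrix n n ℂ) := by
    conv_lhs => rw [hX.spectral_theorem, Unitary.conjStarAlgAut_apply]
  set U := (hX.eigenvectorUnitary : Matrix n n ℂ)
  have h2 : star w ⬝ᵥ (X *ᵥ w) = star (star U *ᵥ w) ⬝ᵥ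
      (diagonal (RCLike.ofReal ∘ hX.eigenvalues) *ᵥ (star U *ᵥ w)) := by
    conv_lhs => rw [h]
    rw [star_mulVec, ← star_eq_conjTranspose, star_star, ← dotProduct_mulVec, mulVec_mulVec,
      mulVec_mulVec]
  rw [h2]
  simp only [dotProduct, mulVec_diagonal, Pi.star_apply, Function.comp_apply]
  push_cast
  refine Finset.sum_congr rfl fun j _ => ?_
  rw [← Complex.conj_mul']
  simp only [RCLike.star_def, Complex.coe_algebraMap]
  exact mul_left_comm _ _ _

theorem Matrix.star_dotProduct_self_eq_sum_of_unitary {U : Matrix n n ℂ}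
    (hU : U ∈ unitaryGroup n ℂ) (w : n → ℂ) :
    star w ⬝ᵥ w = ((∑ j, ‖(star U *ᵥ w) j‖ ^ 2 : ℝ) : ℂ) := by
  have h2 : star w ⬝ᵥ w = star (star U *ᵥ w) ⬝ᵥ (star U *ᵥ w) := by
    rw [star_mulVec, ← star_eq_conjTranspose, star_star, ← dotProduct_mulVec, mulVec_mulVec,
      mem_unitaryGroup_iff.1 hU, one_mulVec]
  rw [h2]
  simp only [dotProduct, Pi.star_apply]
  push_cast
  refine Finset.sum_congr rfl fun j _ => ?_
  rw [← Complex.conj_mul', RCLike.star_def]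

open scoped ComplexOrder in
/-- **Weyl's monotonicity principle** for the ordered eigenvalues of Hermitian matrices. -/
theorem Matrix.IsHermitian.eigenvalues_le_eigenvalues {X Y : Matrix n n ℂ} (hX : X.IsHermitian)
    (hY : Y.IsHermitian) (hXY : X ≤ Y) (i : n) : hX.eigenvalues i ≤ hY.eigenvalues i := by
  by_contra! hlt
  -- This is the enumeration through which `eigenvalues` is defined from the decreasing
  -- `eigenvalues₀`.
  let e : n ≃ Fin (Fintype.card n) := (Fintype.equivOfCardEq (Fintype.card_fin _)).symm
  have monoX : ∀ j k, e j ≤ e k → hX.eigenvalues k ≤ hX.eigenvalues j :=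
    fun j k h => hX.eigenvalues₀_antitone h
  have monoY : ∀ j k, e j ≤ e k → hY.eigenvalues k ≤ hY.eigenvalues j :=
    fun j k h => hY.eigenvalues₀_antitone h
  let U : Matrix n n ℂ := star (hX.eigenvectorUnitary : Matrix n n ℂ)
  let V : Matrix n n ℂ := star (hY.eigenvectorUnitary : Matrix n n ℂ)
  -- Dimension count: there is one row fewer than columns, so some `w ≠ 0` is orthogonal to the
  -- `X`-eigenvectors after `i` and to the `Y`-eigenvectors before `i`.
  let W : Matrix {j // j ≠ i} n ℂ := fun j => if e i < e j then U j else V j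
  have hW : ∀ (w : n → ℂ) (j : {j // j ≠ i}),
      (W *ᵥ w) j = if e i < e (j : n) then (U *ᵥ w) j else (V *ᵥ w) j := by
    intro w j
    simp only [mulVec, W]
    split_ifs <;> rfl
  have hker : LinearMap.ker W.mulVecLin ≠ ⊥ := by
    apply LinearMap.ker_ne_bot_of_finrank_lt
    simp only [Module.finrank_fintype_fun_eq_card]
    exact Fintype.card_subtype_lt (x := i) (by simp)
  obtain ⟨w, hw, hw0⟩ := (Submodule.ne_bot_iff _).1 hker
  have hw' : W *ᵥ w = 0 := hw
  have hUz : ∀ j, e i < e j → (U *ᵥ w) j = 0 := by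
    intro j hj
    have hji : j ≠ i := by rintro rfl; exact lt_irrefl _ hj
    have := hW w ⟨j, hji⟩
    rwa [if_pos hj, hw', Pi.zero_apply, eq_comm] at this
  have hVz : ∀ j, e j < e i → (V *ᵥ w) j = 0 := by
    intro j hj
    have hji : j ≠ i := by rintro rfl; exact lt_irrefl _ hj
    have := hW w ⟨j, hji⟩
    rwa [if_neg hj.not_gt, hw', Pi.zero_apply, eq_comm] at this
  have hle : star w ⬝ᵥ (X *ᵥ w) ≤ star w ⬝ᵥ (Y *ᵥ w) := by
    have := (Matrix.le_iff.1 hXY).dotProduct_mulVec_nonneg w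
    rwa [sub_mulVec, dotProduct_sub, sub_nonneg] at this
  rw [hX.star_dotProduct_mulVec_eq_sum, hY.star_dotProduct_mulVec_eq_sum,
    Complex.real_le_real] at hle
  have hs := (star_dotProduct_self_eq_sum_of_unitary hX.eigenvectorUnitary.2 w).symm.trans
    (star_dotProduct_self_eq_sum_of_unitary hY.eigenvectorUnitary.2 w)
  rw [Complex.ofReal_inj] at hs
  have hpos : 0 < ∑ j, ‖(U *ᵥ w) j‖ ^ 2 := by
    refine lt_of_le_of_ne (by positivity) fun h0 => hw0 ?_
    have h1 := star_dotProduct_self_eq_sum_of_unitary hX.eigenvectorUnitary.2 w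
    rw [← h0, Complex.ofReal_zero] at h1
    exact dotProduct_star_self_eq_zero.1 h1
  have h1 : hX.eigenvalues i * ∑ j, ‖(U *ᵥ w) j‖ ^ 2 ≤
      ∑ j, hX.eigenvalues j * ‖(U *ᵥ w) j‖ ^ 2 := by
    rw [Finset.mul_sum]
    refine Finset.sum_le_sum fun j _ => ?_
    rcases lt_or_ge (e i) (e j) with h | h
    · simp [hUz j h]
    · exact mul_le_mul_of_nonneg_right (monoX _ _ h) (by positivity)
  have h2 : ∑ j, hY.eigenvalues j * ‖(V *ᵥ w) j‖ ^ 2 ≤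
      hY.eigenvalues i * ∑ j, ‖(V *ᵥ w) j‖ ^ 2 := by
    rw [Finset.mul_sum]
    refine Finset.sum_le_sum fun j _ => ?_
    rcases lt_or_ge (e j) (e i) with h | h
    · simp [hVz j h]
    · exact mul_le_mul_of_nonneg_right (monoY _ _ h) (by positivity)
  have h3 := mul_lt_mul_of_pos_right hlt hpos
  have h4 : hY.eigenvalues i * ∑ j, ‖(U *ᵥ w) j‖ ^ 2 =
      hY.eigenvalues i * ∑ j, ‖(V *ᵥ w) j‖ ^ 2 := by rw [hs]
  linarith [h1.trans (hle.trans h2)]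

end Weyl

/-! ### Unitarily invariant norms. -/

section Norm

open Matrix

variable {n : Type*} [Fintype n] [DecidableEq n] {N : Matrix n n ℂ → ℝ}

namespace IsUnitarilyInvariantNorm

theorem real_smul (hN : IsUnitarilyInvariantNorm N) {c : ℝ} (hc : 0 ≤ c) (A : Matrix n n ℂ) :
    N (c • A) = c * N A := by
  have : c • A = (c : ℂ) • A := by ext; simp
  rw [this, hN.smul_eq, Complex.norm_real, Real.norm_of_nonneg hc]

theorem sum_le (hN : IsUnitarilyInvariantNorm N) {ι : Type*} (s : Finset ι)
    (f : ι → Matrix n n ℂ) : N (∑ i ∈ s, f i) ≤ ∑ i ∈ s, N (f i) :=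
  Finset.le_sum_of_subadditive N (le_of_eq (by simpa using hN.smul_eq 0 0)) hN.add_le s f

theorem continuous (hN : IsUnitarilyInvariantNorm N) : Continuous N := by
  have hbound : ∀ A B : Matrix n n ℂ,
      |N A - N B| ≤ ∑ i, ∑ j, ‖A i j - B i j‖ * N (Matrix.single i j 1) := by
    have hsub : ∀ A B : Matrix n n ℂ,
        N A - N B ≤ ∑ i, ∑ j, ‖A i j - B i j‖ * N (Matrix.single i j 1) := by
      intro A B
      have h1 := hN.add_le (A - B) B
      rw [sub_add_cancel] at h1
      have h2 : N (A - B) ≤ ∑ i, ∑ j, ‖A i j - B i j‖ * N (Matrix.single i j 1) := by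
        conv_lhs => rw [matrix_eq_sum_single (A - B)]
        refine (hN.sum_le _ _).trans (Finset.sum_le_sum fun i _ => (hN.sum_le _ _).trans_eq
          (Finset.sum_congr rfl fun j _ => ?_))
        rw [← hN.smul_eq, smul_single, smul_eq_mul, mul_one, Matrix.sub_apply]
      linarith
    intro A B
    rw [abs_le]
    refine ⟨?_, hsub A B⟩
    have := hsub B A
    simp only [norm_sub_rev (B _ _)] at this
    linarith
  rw [continuous_iff_continuousAt]
  intro B
  rw [ContinuousAt, tendsto_iff_dist_tendsto_zero]
  refine squeeze_zero (fun _ => dist_nonneg) (fun A => (Real.dist_eq _ _).trans_le (hbound A B)) ?_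
  have : Continuous fun A : Matrix n n ℂ =>
      ∑ i, ∑ j, ‖A i j - B i j‖ * N (Matrix.single i j 1) := by fun_prop
  simpa using this.tendsto B

/-- Writing `a i = b i * cos θ i` exhibits the smaller diagonal matrix as the average of two unitary
multiples of the larger one. -/
theorem diagonal_le (hN : IsUnitarilyInvariantNorm N) {a b : n → ℝ} (ha : ∀ i, 0 ≤ a i)
    (hab : ∀ i, a i ≤ b i) :
    N (diagonal (fun i => (a i : ℂ))) ≤ N (diagonal (fun i => (b i : ℂ))) := by
  let θ : n → ℝ := fun i => Real.arccos (a i / b i)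
  let D : ℝ → Matrix n n ℂ := fun r => diagonal (fun i => Complex.exp ((r * θ i : ℝ) * Complex.I))
  have hD : ∀ r, D r ∈ unitaryGroup n ℂ := by
    intro r
    rw [mem_unitaryGroup_iff, star_eq_conjTranspose, diagonal_conjTranspose, diagonal_mul_diagonal,
      ← diagonal_one]
    congr 1
    funext i
    rw [Pi.star_apply, RCLike.star_def, Complex.mul_conj', Complex.norm_exp_ofReal_mul_I]
    simp
  have hdec : diagonal (fun i => (a i : ℂ)) =
      (1 / 2 : ℂ) • (D 1 * diagonal (fun i => (b i : ℂ)) * 1) +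
      (1 / 2 : ℂ) • (D (-1) * diagonal (fun i => (b i : ℂ)) * 1) := by
    simp only [D, mul_one, diagonal_mul_diagonal, ← diagonal_smul, diagonal_add]
    congr 1
    funext i
    have hcos : (a i : ℂ) = Complex.cos (θ i : ℂ) * (b i : ℂ) := by
      rw [← Complex.ofReal_cos, ← Complex.ofReal_mul]
      congr 1
      rcases eq_or_lt_of_le ((ha i).trans (hab i)) with h0 | h0
      · rw [← h0, mul_zero]
        exact le_antisymm ((hab i).trans h0.symm.le) (ha i)
      · rw [Real.cos_arccos, div_mul_cancel₀ _ h0.ne']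
        · exact le_trans (by norm_num) (div_nonneg (ha i) h0.le)
        · exact (div_le_one h0).2 (hab i)
    rw [hcos, Complex.cos]
    simp only [Pi.smul_apply, smul_eq_mul]
    push_cast
    ring_nf
  rw [hdec]
  refine (hN.add_le _ _).trans_eq ?_
  rw [hN.smul_eq, hN.smul_eq, hN.unitary_mul_mul _ (hD 1) _ (one_mem _),
    hN.unitary_mul_mul _ (hD (-1)) _ (one_mem _)]
  norm_num
  ring

theorem exp_eq_diagonal (hN : IsUnitarilyInvariantNorm N) {X : Matrix n n ℂ}
    (hX : X.IsHermitian) :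
    N (NormedSpace.exp X) = N (diagonal (fun i => (Real.exp (hX.eigenvalues i) : ℂ))) := by
  have h1 : NormedSpace.exp X = cfc Real.exp X := by
    open scoped Matrix.Norms.L2Operator in
    exact (CFC.real_exp_eq_normedSpace_exp hX.isSelfAdjoint).symm
  rw [h1, hX.cfc_eq, Matrix.IsHermitian.cfc, Unitary.conjStarAlgAut_apply]
  exact hN.unitary_mul_mul _ hX.eigenvectorUnitary.2 _ (star hX.eigenvectorUnitary).2 _

/-- `exp` is not operator monotone, so the comparison passes through the ordered eigenvalues. -/
theorem exp_le_exp (hN : IsUnitarilyInvariantNorm N) {X Y : Matrix n n ℂ} (hX : X.IsHermitian)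
    (hY : Y.IsHermitian) (hXY : X ≤ Y) : N (NormedSpace.exp X) ≤ N (NormedSpace.exp Y) := by
  rw [hN.exp_eq_diagonal hX, hN.exp_eq_diagonal hY]
  exact hN.diagonal_le (fun i => (Real.exp_pos _).le)
    fun i => Real.exp_le_exp.2 (hX.eigenvalues_le_eigenvalues hY hXY i)

end IsUnitarilyInvariantNorm

end Norm

/-! ### Geometric means and logarithms in C⋆-algebras. -/

section CStar

variable {𝒜 : Type*} [CStarAlgebra 𝒜] [PartialOrder 𝒜] [StarOrderedRing 𝒜]

theorem IsSelfAdjoint.isStrictlyPositive_exp {a : 𝒜} (ha : IsSelfAdjoint a) :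
    IsStrictlyPositive (NormedSpace.exp a) :=
  let +nondep : NormedAlgebra ℚ 𝒜 := .restrictScalars ℚ ℝ 𝒜
  (NormedSpace.isUnit_exp a).isStrictlyPositive ha.exp_nonneg

theorem CFC.log_rpow {a : 𝒜} (ha : IsStrictlyPositive a) (r : ℝ) :
    CFC.log (a ^ r) = r • CFC.log a := by
  have hpos : ∀ x ∈ spectrum ℝ a, 0 < x := fun x hx => by grind
  have hne : ∀ x ∈ spectrum ℝ a, x ≠ 0 := fun x hx => (hpos x hx).ne'
  have h1 : ContinuousOn (fun x : ℝ => x ^ r) (spectrum ℝ a) :=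
    ContinuousOn.rpow_const continuousOn_id fun x hx => .inl (hne x hx)
  have h2 : ContinuousOn Real.log ((fun x : ℝ => x ^ r) '' spectrum ℝ a) := by
    refine Real.continuousOn_log.mono ?_
    rintro _ ⟨x, hx, rfl⟩
    exact (Real.rpow_pos_of_pos (hpos x hx) r).ne'
  rw [CFC.rpow_eq_cfc_real ha.nonneg, CFC.log, CFC.log, ← cfc_comp' Real.log _ a h2 h1,
    ← cfc_smul r Real.log a (Real.continuousOn_log.mono hne)]
  exact cfc_congr fun x hx => Real.log_rpow (hpos x hx) r

theorem CFC.exp_smul_rpow {a : 𝒜} (ha : IsSelfAdjoint a) (r : ℝ) :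
    NormedSpace.exp a ^ r = NormedSpace.exp (r • a) := by
  have h := CFC.log_rpow ha.isStrictlyPositive_exp r
  rw [CFC.log_exp a] at h
  rw [← h, CFC.exp_log _ (ha.isStrictlyPositive_exp.rpow _ _)]

theorem CFC.smul_rpow {a : 𝒜} (ha : IsStrictlyPositive a) {c : ℝ} (hc : 0 < c) (r : ℝ) :
    (c • a) ^ r = c ^ r • a ^ r := by
  have hca : IsStrictlyPositive (c • a) :=  ha.smul hc
  have har := ha.rpow a r
  rw [← CFC.exp_log ((c • a) ^ r) (hca.rpow _ _), CFC.log_rpow hca, CFC.log_smul' a hc ha,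
    ← CFC.exp_log (c ^ r • a ^ r) (har.smul (Real.rpow_pos_of_pos hc r)),
    CFC.log_smul' _ (Real.rpow_pos_of_pos hc r) har, CFC.log_rpow ha, Real.log_rpow hc,
    smul_add, map_mul, Algebra.smul_def r (algebraMap ℝ 𝒜 _)]

theorem rpow_half_mul_self {a : 𝒜} (ha : IsStrictlyPositive a) :
    a ^ (1 / 2 : ℝ) * a ^ (1 / 2 : ℝ) = a := by
  rw [← CFC.rpow_add ha.isUnit, add_halves, CFC.rpow_one a ha.nonneg]

theorem rpow_half_conj_rpow_neg_half {a : 𝒜} (ha : IsStrictlyPositive a) (b : 𝒜) :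
    a ^ (1 / 2 : ℝ) * (a ^ (-(1 / 2) : ℝ) * b * a ^ (-(1 / 2) : ℝ)) * a ^ (1 / 2 : ℝ) = b := by
  have h1 := CFC.rpow_mul_rpow_neg (a := a) (1 / 2) ha
  have h2 := CFC.rpow_neg_mul_rpow (a := a) (1 / 2) ha
  calc _ = (a ^ (1 / 2 : ℝ) * a ^ (-(1 / 2) : ℝ)) * b *
        (a ^ (-(1 / 2) : ℝ) * a ^ (1 / 2 : ℝ)) := by simp only [mul_assoc]
    _ = b := by rw [h1, h2, one_mul, mul_one]

theorem isStrictlyPositive_rpow_conj {a b : 𝒜} (ha : IsStrictlyPositive a)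
    (hb : IsStrictlyPositive b) (r : ℝ) : IsStrictlyPositive (a ^ r * b * a ^ r) := by
  have hu := (ha.rpow a r).isUnit
  refine ((hu.mul hb.isUnit).mul hu).isStrictlyPositive ?_
  simpa using conjugate_le_conjugate_of_nonneg hb.nonneg (CFC.rpow_nonneg (a := a) (y := r))

theorem rpow_neg_half_conj_self {a : 𝒜} (ha : IsStrictlyPositive a) :
    a ^ (-(1 / 2) : ℝ) * a * a ^ (-(1 / 2) : ℝ) = 1 := by
  have h1 := CFC.rpow_mul_rpow_neg (a := a) (1 / 2) ha
  have h2 := CFC.rpow_neg_mul_rpow (a := a) (1 / 2) ha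
  calc _ = (a ^ (-(1 / 2) : ℝ) * a ^ (1 / 2 : ℝ)) * (a ^ (1 / 2 : ℝ) * a ^ (-(1 / 2) : ℝ)) := by
        nth_rw 2 [← rpow_half_mul_self ha]
        simp only [mul_assoc]
    _ = 1 := by rw [h1, h2, one_mul]

/-- Operator form of a two-sided comparison of `(1 - α) + α x` with multiples of `x ^ α`. -/
theorem weighted_geomMean_bounds {a b : 𝒜} (ha : IsStrictlyPositive a)
    (hb : IsStrictlyPositive b) {α l u M : ℝ} (h0 : 0 ≤ α) (h1 : α ≤ 1)
    (hl : l • a ≤ b) (hu : b ≤ u • a)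
    (hM : ∀ x, 0 < x → l ≤ x → x ≤ u → (1 - α) + α * x ≤ M * x ^ α) :
    (1 - α) • a + α • b ≤
        M • (a ^ (1 / 2 : ℝ) * (a ^ (-(1 / 2) : ℝ) * b * a ^ (-(1 / 2) : ℝ)) ^ α * a ^ (1 / 2 : ℝ)) ∧
      a ^ (1 / 2 : ℝ) * (a ^ (-(1 / 2) : ℝ) * b * a ^ (-(1 / 2) : ℝ)) ^ α * a ^ (1 / 2 : ℝ) ≤
        (1 - α) • a + α • b := by
  set c := a ^ (-(1 / 2) : ℝ) * b * a ^ (-(1 / 2) : ℝ) with hc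
  have hcpos : IsStrictlyPositive c := isStrictlyPositive_rpow_conj ha hb _
  have hcsa : IsSelfAdjoint c := hcpos.nonneg.isSelfAdjoint
  have hnn : 0 ≤ a ^ (-(1 / 2) : ℝ) := CFC.rpow_nonneg
  have hcl : algebraMap ℝ 𝒜 l ≤ c := by
    have := conjugate_le_conjugate_of_nonneg hl hnn
    rwa [mul_smul_comm, smul_mul_assoc, rpow_neg_half_conj_self ha,
      ← Algebra.algebraMap_eq_smul_one] at this
  have hcu : c ≤ algebraMap ℝ 𝒜 u := by
    have := conjugate_le_conjugate_of_nonneg hu hnn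
    rwa [mul_smul_comm, smul_mul_assoc, rpow_neg_half_conj_self ha,
      ← Algebra.algebraMap_eq_smul_one] at this
  have hsl := (algebraMap_le_iff_le_spectrum (a := c)).1 hcl
  have hsu := (le_algebraMap_iff_spectrum_le (a := c)).1 hcu
  have hpos : ∀ x ∈ spectrum ℝ c, 0 < x := fun x hx => by grind
  have hcont : ContinuousOn (fun x : ℝ => x ^ α) (spectrum ℝ c) :=
    ContinuousOn.rpow_const continuousOn_id fun x hx => .inl (hpos x hx).ne'
  have hlin : cfc (fun x : ℝ => (1 - α) + α * x) c = (1 - α) • (1 : 𝒜) + α • c := by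
    rw [cfc_const_add (1 - α) _ c, cfc_const_mul_id α c, Algebra.algebraMap_eq_smul_one]
  have hpow : c ^ α = cfc (fun x : ℝ => x ^ α) c := CFC.rpow_eq_cfc_real hcpos.nonneg
  have hMpow : M • c ^ α = cfc (fun x : ℝ => M * x ^ α) c := by
    rw [cfc_const_mul M _ c hcont, hpow]
  have hup : (1 - α) • (1 : 𝒜) + α • c ≤ M • c ^ α := by
    rw [← hlin, hMpow]
    exact cfc_mono (fun x hx => hM x (hpos x hx) (hsl x hx) (hsu x hx))
      (hg := continuousOn_const.mul hcont)
  have hlow : c ^ α ≤ (1 - α) • (1 : 𝒜) + α • c := by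
    rw [← hlin, hpow]
    refine cfc_mono (fun x hx => ?_) (hf := hcont)
    have := Real.geom_mean_le_arith_mean2_weighted (sub_nonneg.2 h1) h0 zero_le_one
      (hpos x hx).le (by ring)
    simpa using this
  have hnn' : 0 ≤ a ^ (1 / 2 : ℝ) := CFC.rpow_nonneg
  have hconj : a ^ (1 / 2 : ℝ) * ((1 - α) • (1 : 𝒜) + α • c) * a ^ (1 / 2 : ℝ) =
      (1 - α) • a + α • b := by
    rw [mul_add, add_mul, mul_smul_comm, mul_smul_comm, smul_mul_assoc, smul_mul_assoc, mul_one,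
      rpow_half_mul_self ha, hc, rpow_half_conj_rpow_neg_half ha]
  constructor
  · have := conjugate_le_conjugate_of_nonneg hup hnn'
    rwa [hconj, mul_smul_comm, smul_mul_assoc] at this
  · have := conjugate_le_conjugate_of_nonneg hlow hnn'
    rwa [hconj] at this

/-- Squeezing works because the norm is monotone on positive elements: `0 ≤ g - f ≤ h - f`. -/
theorem tendsto_of_tendsto_of_le_of_le_of_cstar {ι : Type*} {l : Filter ι} {f g h : ι → 𝒜} {x : 𝒜}
    (hf : Filter.Tendsto f l (𝓝 x)) (hh : Filter.Tendsto h l (𝓝 x))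
    (hfg : ∀ᶠ i in l, f i ≤ g i) (hgh : ∀ᶠ i in l, g i ≤ h i) :
    Filter.Tendsto g l (𝓝 x) := by
  have h1 : Filter.Tendsto (fun i => g i - f i) l (𝓝 0) := by
    refine squeeze_zero_norm' (a := fun i => ‖h i - f i‖) ?_ ?_
    · filter_upwards [hfg, hgh] with i h1 h2
      exact CStarAlgebra.norm_le_norm_of_nonneg_of_le (sub_nonneg.2 h1) (sub_le_sub_right h2 _)
    · simpa using (hh.sub hf).norm
  simpa using h1.add hf

omit [PartialOrder 𝒜] [StarOrderedRing 𝒜] in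
theorem tendsto_inv_smul_exp_smul_sub_one (a : 𝒜) :
    Filter.Tendsto (fun p : ℝ => p⁻¹ • (NormedSpace.exp (p • a) - 1)) (𝓝[>] 0) (𝓝 a) := by
  have := (hasDerivAt_exp_smul_const (𝕂 := ℝ) a (0 : ℝ)).tendsto_slope_zero_right
  simpa using this

theorem CFC.log_le_sub_one {a : 𝒜} (ha : IsStrictlyPositive a) : CFC.log a ≤ a - 1 := by
  have hpos : ∀ x ∈ spectrum ℝ a, 0 < x := fun x hx => by grind
  have h : a - 1 = cfc (fun x : ℝ => x - 1) a := by
    rw [cfc_sub (fun x : ℝ => x) (fun _ => 1) a, cfc_id' ℝ a, cfc_const_one ℝ a]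
  rw [h, CFC.log]
  exact cfc_mono (fun x hx => Real.log_le_sub_one_of_pos (hpos x hx))
    (hf := Real.continuousOn_log.mono fun x hx => (hpos x hx).ne')

/-- Comparison of powers for `r > 0` from the Olson order with a scalar factor on the left. -/
theorem smul_exp_le_exp_of_olson_left {a b : 𝒜} (ha : IsSelfAdjoint a) (hb : IsSelfAdjoint b)
    {s : ℝ} (h : ∀ r : ℝ, 1 ≤ r →
      (Real.exp s • NormedSpace.exp a) ^ r ≤ NormedSpace.exp b ^ r) {p : ℝ} (hp : 0 < p) :
    Real.exp (s * p) • NormedSpace.exp (p • a) ≤ NormedSpace.exp (p • b) := by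
  have key : (Real.exp s • NormedSpace.exp a) ^ p ≤ NormedSpace.exp b ^ p := by
    rcases le_total 1 p with h1 | h1
    · exact h p h1
    -- For `p ≤ 1`, the Löwner–Heinz inequality applied to the case `r = 1` suffices.
    · have h2 := h 1 le_rfl
      rw [CFC.rpow_one _ (ha.isStrictlyPositive_exp.smul (Real.exp_pos s)).nonneg,
        CFC.rpow_one _ hb.exp_nonneg] at h2
      exact CFC.rpow_le_rpow ⟨hp.le, h1⟩ h2
  rwa [CFC.smul_rpow ha.isStrictlyPositive_exp (Real.exp_pos s), CFC.exp_smul_rpow ha,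
    CFC.exp_smul_rpow hb, ← Real.exp_mul] at key

theorem exp_le_smul_exp_of_olson_right {a b : 𝒜} (ha : IsSelfAdjoint a) (hb : IsSelfAdjoint b)
    {t : ℝ} (h : ∀ r : ℝ, 1 ≤ r →
      NormedSpace.exp b ^ r ≤ (Real.exp t • NormedSpace.exp a) ^ r) {p : ℝ} (hp : 0 < p) :
    NormedSpace.exp (p • b) ≤ Real.exp (t * p) • NormedSpace.exp (p • a) := by
  have key : NormedSpace.exp b ^ p ≤ (Real.exp t • NormedSpace.exp a) ^ p := by
    rcases le_total 1 p with h1 | h1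
    · exact h p h1
    · have h2 := h 1 le_rfl
      rw [CFC.rpow_one _ (ha.isStrictlyPositive_exp.smul (Real.exp_pos t)).nonneg,
        CFC.rpow_one _ hb.exp_nonneg] at h2
      exact CFC.rpow_le_rpow ⟨hp.le, h1⟩ h2
  rwa [CFC.smul_rpow ha.isStrictlyPositive_exp (Real.exp_pos t), CFC.exp_smul_rpow ha,
    CFC.exp_smul_rpow hb, ← Real.exp_mul] at key

/-- The logarithm of the weighted geometric mean of `exp (p a)` and `exp (p b)`, divided by `p`. -/
noncomputable def logGeomMean (α p : ℝ) (a b : 𝒜) : 𝒜 :=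
  (1 / p) • CFC.log (NormedSpace.exp (p • a) ^ (1 / 2 : ℝ) *
    (NormedSpace.exp (p • a) ^ (-(1 / 2) : ℝ) * NormedSpace.exp (p • b) *
      NormedSpace.exp (p • a) ^ (-(1 / 2) : ℝ)) ^ α * NormedSpace.exp (p • a) ^ (1 / 2 : ℝ))

theorem isSelfAdjoint_logGeomMean (α p : ℝ) (a b : 𝒜) : IsSelfAdjoint (logGeomMean α p a b) :=
  (IsSelfAdjoint.all (1 / p)).smul IsSelfAdjoint.log

theorem isStrictlyPositive_geomMean_exp {a b : 𝒜} (ha : IsSelfAdjoint a) (hb : IsSelfAdjoint b)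
    (α : ℝ) : IsStrictlyPositive (NormedSpace.exp a ^ (1 / 2 : ℝ) *
    (NormedSpace.exp a ^ (-(1 / 2) : ℝ) * NormedSpace.exp b *
      NormedSpace.exp a ^ (-(1 / 2) : ℝ)) ^ α * NormedSpace.exp a ^ (1 / 2 : ℝ)) :=
  isStrictlyPositive_rpow_conj ha.isStrictlyPositive_exp
    ((isStrictlyPositive_rpow_conj ha.isStrictlyPositive_exp hb.isStrictlyPositive_exp _).rpow _ _) _

theorem exp_logGeomMean {a b : 𝒜} (ha : IsSelfAdjoint a) (hb : IsSelfAdjoint b) (α p : ℝ) :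
    NormedSpace.exp (logGeomMean α p a b) = (NormedSpace.exp (p • a) ^ (1 / 2 : ℝ) *
    (NormedSpace.exp (p • a) ^ (-(1 / 2) : ℝ) * NormedSpace.exp (p • b) *
      NormedSpace.exp (p • a) ^ (-(1 / 2) : ℝ)) ^ α *
        NormedSpace.exp (p • a) ^ (1 / 2 : ℝ)) ^ (1 / p) := by
  have h := isStrictlyPositive_geomMean_exp ((IsSelfAdjoint.all p).smul ha)
    ((IsSelfAdjoint.all p).smul hb) α
  rw [logGeomMean, ← CFC.log_rpow h, CFC.exp_log _ (h.rpow _ _)]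

/-- Turns the additive scalar error in the logarithm into the multiplicative Specht factor. -/
theorem exp_algebraMap_log_add {a : 𝒜} {c : ℝ} (hc : 0 < c) (ha : IsSelfAdjoint a) :
    NormedSpace.exp (algebraMap ℝ 𝒜 (Real.log c) + a) = c • NormedSpace.exp a := by
  have hE := ha.isStrictlyPositive_exp
  rw [← CFC.exp_log (c • NormedSpace.exp a) (hE.smul hc), CFC.log_smul' _ hc hE, CFC.log_exp a]

theorem logGeomMean_bounds {a b : 𝒜} (ha : IsSelfAdjoint a) (hb : IsSelfAdjoint b)
    {α p s t : ℝ} (h0 : 0 ≤ α) (h1 : α ≤ 1) (hp : 0 < p)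
    (hs : Real.exp (s * p) • NormedSpace.exp (p • a) ≤ NormedSpace.exp (p • b))
    (ht : NormedSpace.exp (p • b) ≤ Real.exp (t * p) • NormedSpace.exp (p • a)) :
    (1 - α) • a + α • b ≤ algebraMap ℝ 𝒜 (Real.log
        ((max (spechtRatio (Real.exp (s * p))) (spechtRatio (Real.exp (t * p)))) ^ (1 / p))) +
          logGeomMean α p a b ∧
      logGeomMean α p a b ≤ (1 - α) • (p⁻¹ • (NormedSpace.exp (p • a) - 1)) +
        α • (p⁻¹ • (NormedSpace.exp (p • b) - 1)) := by
  have hpa : IsSelfAdjoint (p • a) := (IsSelfAdjoint.all p).smul ha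
  have hpb : IsSelfAdjoint (p • b) := (IsSelfAdjoint.all p).smul hb
  have hA := hpa.isStrictlyPositive_exp
  have hB := hpb.isStrictlyPositive_exp
  set M := max (spechtRatio (Real.exp (s * p))) (spechtRatio (Real.exp (t * p))) with hMdef
  have hM : 0 < M := zero_lt_one.trans_le
    (le_max_of_le_left (one_le_spechtRatio (Real.exp_pos _)))
  obtain ⟨hup, hlow⟩ := weighted_geomMean_bounds hA hB h0 h1 hs ht (M := M)
    (fun x _ h2 h3 => add_mul_le_max_spechtRatio_mul_rpow h0 h1 h2 h3)
  have hG := isStrictlyPositive_geomMean_exp hpa hpb α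
  unfold logGeomMean
  set G := NormedSpace.exp (p • a) ^ (1 / 2 : ℝ) *
    (NormedSpace.exp (p • a) ^ (-(1 / 2) : ℝ) * NormedSpace.exp (p • b) *
      NormedSpace.exp (p • a) ^ (-(1 / 2) : ℝ)) ^ α * NormedSpace.exp (p • a) ^ (1 / 2 : ℝ)
  constructor
  -- Operator concavity of `log` at `exp (p a)` and `exp (p b)`, followed by its operator
  -- monotonicity.
  · have hconc := CFC.concaveOn_log.2 hA hB (sub_nonneg.2 h1) h0 (by ring)
    have hpos : IsStrictlyPositive
        ((1 - α) • NormedSpace.exp (p • a) + α • NormedSpace.exp (p • b)) :=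
      hG.of_le hlow
    have hlog := hconc.trans (CFC.log_le_log hup hpos)
    rw [CFC.log_exp _ hpa, CFC.log_exp _ hpb, CFC.log_smul' _ hM hG] at hlog
    have := smul_le_smul_of_nonneg_left hlog (one_div_nonneg.2 hp.le)
    rw [Real.log_rpow hM, map_mul, ← Algebra.smul_def, ← smul_add]
    refine le_trans (le_of_eq ?_) this
    rw [smul_add, smul_comm (1 - α), smul_comm α, smul_smul, smul_smul, smul_smul, smul_smul]
    congr 2 <;> field_simp
  -- Here `log G ≤ G - 1`, and `G` is at most the arithmetic mean.
  · have h2 := smul_le_smul_of_nonneg_left ((CFC.log_le_sub_one hG).trans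
      (sub_le_sub_right hlow 1)) (one_div_nonneg.2 hp.le)
    refine h2.trans_eq ?_
    rw [one_div]
    module

theorem tendsto_logGeomMean {a b : 𝒜} (ha : IsSelfAdjoint a) (hb : IsSelfAdjoint b)
    {α s t : ℝ} (h0 : 0 ≤ α) (h1 : α ≤ 1)
    (hs : ∀ p, 0 < p → Real.exp (s * p) • NormedSpace.exp (p • a) ≤ NormedSpace.exp (p • b))
    (ht : ∀ p, 0 < p → NormedSpace.exp (p • b) ≤ Real.exp (t * p) • NormedSpace.exp (p • a)) :
    Filter.Tendsto (fun p => logGeomMean α p a b) (𝓝[>] 0) (𝓝 ((1 - α) • a + α • b)) := by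
  have hlog : Filter.Tendsto (fun p : ℝ => algebraMap ℝ 𝒜 (Real.log
      ((max (spechtRatio (Real.exp (s * p))) (spechtRatio (Real.exp (t * p)))) ^ (1 / p))))
      (𝓝[>] 0) (𝓝 0) := by
    have h := ((continuous_algebraMap ℝ 𝒜).tendsto _).comp
      ((tendsto_max_spechtRatio_rpow s t).log one_ne_zero)
    rw [Real.log_one, map_zero] at h
    exact h
  refine tendsto_of_tendsto_of_le_of_le_of_cstar
    (by simpa only [sub_zero] using (tendsto_const_nhds (x := (1 - α) • a + α • b)).sub hlog)
    (((tendsto_inv_smul_exp_smul_sub_one a).const_smul (1 - α)).add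
      ((tendsto_inv_smul_exp_smul_sub_one b).const_smul α)) ?_ ?_
  · filter_upwards [self_mem_nhdsWithin] with p hp
    rw [sub_le_iff_le_add']
    exact (logGeomMean_bounds ha hb h0 h1 hp (hs p hp) (ht p hp)).1
  · filter_upwards [self_mem_nhdsWithin] with p hp
    exact (logGeomMean_bounds ha hb h0 h1 hp (hs p hp) (ht p hp)).2

end CStar

/-! ### The norm inequality and its limit for matrices. -/

section Main

variable {n : Type*} [Fintype n] [DecidableEq n] {N : Matrix n n ℂ → ℝ}

theorem IsUnitarilyInvariantNorm.exp_le_specht_mul_geomMean (hN : IsUnitarilyInvariantNorm N)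
    {H K : Matrix n n ℂ} (hH : H.IsHermitian) (hK : K.IsHermitian) {α p s t : ℝ}
    (h0 : 0 ≤ α) (h1 : α ≤ 1) (hp : 0 < p)
    (hs : Real.exp (s * p) • NormedSpace.exp (p • H) ≤ NormedSpace.exp (p • K))
    (ht : NormedSpace.exp (p • K) ≤ Real.exp (t * p) • NormedSpace.exp (p • H)) :
    N (NormedSpace.exp ((1 - α) • H + α • K)) ≤
      (max (spechtRatio (Real.exp (s * p))) (spechtRatio (Real.exp (t * p)))) ^ (1 / p) *
        N ((geomMean α (NormedSpace.exp (p • H)) (NormedSpace.exp (p • K))) ^ (1 / p)) := by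
  -- The operator norm only supplies the C⋆-algebra structure; it is independent of `N`.
  open scoped Matrix.Norms.L2Operator in
  have hM : 0 < (max (spechtRatio (Real.exp (s * p))) (spechtRatio (Real.exp (t * p)))) ^ (1 / p) :=
    Real.rpow_pos_of_pos (zero_lt_one.trans_le
      (le_max_of_le_left (one_le_spechtRatio (Real.exp_pos _)))) _
  open scoped Matrix.Norms.L2Operator in
  have hle := (logGeomMean_bounds hH.isSelfAdjoint hK.isSelfAdjoint h0 h1 hp hs ht).1
  open scoped Matrix.Norms.L2Operator in
  have hexp := exp_logGeomMean hH.isSelfAdjoint hK.isSelfAdjoint α p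
  open scoped Matrix.Norms.L2Operator in
  have hZ := isSelfAdjoint_logGeomMean α p H K
  open scoped Matrix.Norms.L2Operator in
  have hmul := exp_algebraMap_log_add hM hZ
  open scoped Matrix.Norms.L2Operator in
  have hsa := (IsSelfAdjoint.algebraMap (Matrix n n ℂ) (IsSelfAdjoint.all (Real.log
    ((max (spechtRatio (Real.exp (s * p))) (spechtRatio (Real.exp (t * p)))) ^ (1 / p))))).add hZ
  have hX : ((1 - α) • H + α • K).IsHermitian :=
    ((IsSelfAdjoint.all (1 - α)).smul hH.isSelfAdjoint).add
      ((IsSelfAdjoint.all α).smul hK.isSelfAdjoint)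
  have h := hN.exp_le_exp hX hsa hle
  rw [← hN.real_smul hM.le]
  refine h.trans_eq (congrArg N ?_)
  refine hmul.trans ?_
  rw [hexp]
  rfl

theorem IsUnitarilyInvariantNorm.tendsto_specht_mul_geomMean (hN : IsUnitarilyInvariantNorm N)
    {H K : Matrix n n ℂ} (hH : H.IsHermitian) (hK : K.IsHermitian) {α s t : ℝ}
    (h0 : 0 ≤ α) (h1 : α ≤ 1)
    (hs : ∀ p, 0 < p → Real.exp (s * p) • NormedSpace.exp (p • H) ≤ NormedSpace.exp (p • K))
    (ht : ∀ p, 0 < p → NormedSpace.exp (p • K) ≤ Real.exp (t * p) • NormedSpace.exp (p • H)) :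
    Filter.Tendsto
      (fun p : ℝ =>
        (max (spechtRatio (Real.exp (s * p))) (spechtRatio (Real.exp (t * p)))) ^ (1 / p) *
          N ((geomMean α (NormedSpace.exp (p • H)) (NormedSpace.exp (p • K))) ^ (1 / p)))
      (𝓝[>] 0) (𝓝 (N (NormedSpace.exp ((1 - α) • H + α • K)))) := by
  open scoped Matrix.Norms.L2Operator in
  have hexp : Filter.Tendsto
      (fun p : ℝ => (geomMean α (NormedSpace.exp (p • H)) (NormedSpace.exp (p • K))) ^ (1 / p))
      (𝓝[>] 0) (𝓝 (NormedSpace.exp ((1 - α) • H + α • K))) := by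
    let +nondep : NormedAlgebra ℚ (Matrix n n ℂ) := .restrictScalars ℚ ℝ (Matrix n n ℂ)
    have h := (NormedSpace.exp_continuous (𝔸 := Matrix n n ℂ)).tendsto _ |>.comp
      (tendsto_logGeomMean hH.isSelfAdjoint hK.isSelfAdjoint h0 h1 hs ht)
    exact h.congr fun p => exp_logGeomMean hH.isSelfAdjoint hK.isSelfAdjoint α p
  have h2 := (tendsto_max_spechtRatio_rpow s t).mul ((hN.continuous.tendsto _).comp hexp)
  rw [one_mul] at h2
  exact h2

end Main

theorem corollary2p5 {n : Type*} [Fintype n] [DecidableEq n]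
    (H K : Matrix n n ℂ) (hH : H.IsHermitian) (hK : K.IsHermitian)
    (s t : ℝ) (hst : s ≤ t)
    (hs : OlsonLE (Real.exp s • NormedSpace.exp H) (NormedSpace.exp K))
    (ht : OlsonLE (NormedSpace.exp K) (Real.exp t • NormedSpace.exp H))
    (N : Matrix n n ℂ → ℝ) (hN : IsUnitarilyInvariantNorm N) :
    (∀ α : ℝ, 0 ≤ α → α ≤ 1 →
      (∀ p : ℝ, 0 < p →
        N (NormedSpace.exp ((1 - α) • H + α • K)) ≤
          (max (spechtRatio (Real.exp (s * p))) (spechtRatio (Real.exp (t * p)))) ^ (1 / p) *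
            N ((geomMean α (NormedSpace.exp (p • H)) (NormedSpace.exp (p • K))) ^ (1 / p))) ∧
      Filter.Tendsto
        (fun p : ℝ =>
          (max (spechtRatio (Real.exp (s * p))) (spechtRatio (Real.exp (t * p)))) ^ (1 / p) *
            N ((geomMean α (NormedSpace.exp (p • H)) (NormedSpace.exp (p • K))) ^ (1 / p)))
        (𝓝[>] 0) (𝓝 (N (NormedSpace.exp ((1 - α) • H + α • K))))) ∧
    N (NormedSpace.exp (H + K)) ≤
      max (spechtRatio (Real.exp (2 * s))) (spechtRatio (Real.exp (2 * t))) *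
        N (geomMean (1 / 2) (NormedSpace.exp ((2 : ℝ) • H)) (NormedSpace.exp ((2 : ℝ) • K))) := by
  have hs' : ∀ p : ℝ, 0 < p →
      Real.exp (s * p) • NormedSpace.exp (p • H) ≤ NormedSpace.exp (p • K) := by
    open scoped Matrix.Norms.L2Operator in
    exact fun p hp => smul_exp_le_exp_of_olson_left hH.isSelfAdjoint hK.isSelfAdjoint hs hp
  have ht' : ∀ p : ℝ, 0 < p →
      NormedSpace.exp (p • K) ≤ Real.exp (t * p) • NormedSpace.exp (p • H) := by
    open scoped Matrix.Norms.L2Operator in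
    exact fun p hp => exp_le_smul_exp_of_olson_right hH.isSelfAdjoint hK.isSelfAdjoint ht hp
  refine ⟨fun α h0 h1 => ⟨fun p hp =>
    hN.exp_le_specht_mul_geomMean hH hK h0 h1 hp (hs' p hp) (ht' p hp),
    hN.tendsto_specht_mul_geomMean hH hK h0 h1 hs' ht'⟩, ?_⟩
  have h2H : ((2 : ℝ) • H).IsHermitian := (IsSelfAdjoint.all (2 : ℝ)).smul hH.isSelfAdjoint
  have h2K : ((2 : ℝ) • K).IsHermitian := (IsSelfAdjoint.all (2 : ℝ)).smul hK.isSelfAdjoint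
  -- Using `2H`, `2K` with `p = 1`, rather than `H`, `K` with `p = 2`, leaves the geometric mean
  -- without a square root.
  have h := hN.exp_le_specht_mul_geomMean h2H h2K (α := 1 / 2) (p := 1) (s := 2 * s) (t := 2 * t)
    (by norm_num) (by norm_num) one_pos
    (by simpa only [one_smul, mul_one, mul_comm s] using hs' 2 two_pos)
    (by simpa only [one_smul, mul_one, mul_comm t] using ht' 2 two_pos)
  have hsum : (1 - 1 / 2 : ℝ) • (2 : ℝ) • H + (1 / 2 : ℝ) • (2 : ℝ) • K = H + K := by module
  have hpos : 0 ≤ geomMean (1 / 2) (NormedSpace.exp ((2 : ℝ) • H))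
      (NormedSpace.exp ((2 : ℝ) • K)) := by
    open scoped Matrix.Norms.L2Operator in
    exact (isStrictlyPositive_geomMean_exp h2H.isSelfAdjoint h2K.isSelfAdjoint (1 / 2)).nonneg
  rw [hsum] at h
  simpa only [one_smul, mul_one, div_one, Real.rpow_one, CFC.rpow_one _ hpos] using h
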